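/- Let $N\ge 1$ and $W_n=\{x\in\mathbb Z^n : x_1<\dots<x_n\}$, $\Delta_n(x)=\prod_{1\le i<j\le n}(x_j-x_i)$. For $y\in\mathbb Z^{n}$ and $x\in\mathbb Z^{n+1}$ write $y\prec x$ if $x_1<y_1\le x_2<y_2\le\dots<y_n\le x_{n+1}$, and let $GT_N$ be the set of Gelfand–Tsetlin patterns $X=(x^1,\dots,x^N)$, $x^n=(x^n_1,\dots,x^n_n)\in\mathbb Z^n$, $x^1\prec x^2\prec\dots\prec x^N$. For $p\in[0,1]$ let $P(u,v)=p\,\mathbf 1_{v=u+1}+(1-p)\,\mathbf 1_{v=u}$ on $\mathbb Z$, let $$P_n(x,y)=\frac{\Delta_n(y)}{\Delta_n(x)}\det\big(P(x_i,y_j)\big)_{i,j=1}^n\quad(x,y\in W_n)$$ (the discrete-time analogue of the Charlier process), let $$\Lambda^n_{n-1}(x,y)=(n-1)!\,\frac{\Delta_{n-1}(y)}{\Delta_n(x)}\mathbf 1_{y\prec x}\quad(x\in W_n,\ y\in W_{n-1}),\qquad \Delta^n_{n-1}=P_n\Lambda^n_{n-1},$$ and define the intertwined discrete-time chain on $GT_N$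 by $$P_\Lambda(X,Y)=P_1(x^1,y^1)\prod_{k=2}^N\frac{P_k(x^k,y^k)\,\Lambda^k_{k-1}(y^k,y^{k-1})}{\Delta^k_{k-1}(x^k,y^{k-1})}$$ if $\prod_{k=2}^N\Delta^k_{k-1}(x^k,y^{k-1})>0$, and $P_\Lambda(X,Y)=0$ otherwise. Let $\pi(X)=(x^1_1,x^2_1,\dots,x^N_1)$ be the projection onto the leftmost particles; its values lie in $\{z\in\mathbb Z^N: z_1>z_2>\dots>z_N\}$. Discrete-time TASEP with sequential update is the chain on $\{z_1>\dots>z_N\}$ with one-step matrix $T_p$ in which the particles $1,2,\dots,N$ are updated in this order, each one jumping one site to the right with probability $p$ and staying with probability $1-p$, except that particle $n\ge2$ stays put if the site to its right is occupied by the already updated particle $n-1$. Continuous-time TASEP with $N$ particles has transition probabilities $Q_t(x,y)=(e^{tL}\mathbf 1_{\{y\}})(x)$, where $(Lf)(x)=\sum_{n}\mathbf 1[\text{the site } x_n+1 \text{ is empty}]\,(f(x+e_n)-f(x))$. 1. For every $p\in[0,1]$, $P_\Lambda$ and $T_p$ are stochastic matrices, and $\sum_{Y:\pi(Y)=y}P_\Lambda(X,Y)=T_p(\pi(X),y)$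 for all $X\in GT_N$ and all $y$. If $(X(k))_{k\ge0}$ is a Markov chain on $GT_N$ with transition matrix $P_\Lambda$ and any initial law, then $(\pi(X(k)))_{k\ge0}$ is a Markov chain with transition matrix $T_p$. 2. For all $t\ge0$ and all states, the limits $$R_t(X,Y)=\lim_{p\downarrow0}(P_\Lambda)^{\lfloor t/p\rfloor}(X,Y),\qquad \lim_{p\downarrow0}(T_p)^{\lfloor t/p\rfloor}(x,y)=Q_t(x,y)$$ exist, the second one having the stated value. Both $R_t$ (the continuous-time intertwined chain on $GT_N$) and $Q_t$ are transition functions of continuous-time Markov chains: stochastic matrices, equal to the identity at $t=0$, satisfying the Chapman–Kolmogorov equations, and with diagonal entries tending to $1$ as $t\downarrow0$. 3. For all $t\ge0$, $X\in GT_N$ and $y$ one has $\sum_{Y:\pi(Y)=y}R_t(X,Y)=Q_t(\pi(X),y)$. If $(X(t))_{t\ge0}$ is a Markov chain on $GT_N$ with transition function $R_t$ and any initial law, then its projection $(x^1_1(t),\dots,x^N_1(t))_{t\ge0}$ is again a Markov chain, namely continuous-time TASEP with $N$ particles, i.e. the Markov chain with transition function $Q_t$; and the path of the projection is right-continuous with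 left limits whenever the path of $X$ is. -/

import Mathlib

open Filter Topology MeasureTheory
open scoped NNReal

noncomputable section

namespace GTTasep

/-! ### Markov chains on countable state spaces -/

section Markov

variable {S S' T : Type*}

/-- A stochastic matrix: nonnegative entries, all rows sum to one. -/
structure IsStochastic (K : S → S → ℝ) : Prop where
  nonneg : ∀ x y, 0 ≤ K x y
  hasSum_one : ∀ x, HasSum (K x) 1

open Classical in
/-- The powers `K ^ n` of a matrix indexed by `S` (the `n`-step transition probabilities). -/
def kernelPow (K : S → S → ℝ) : ℕ → S → S → ℝ
  | 0 => fun x y => if x = y then 1 else 0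
  | n + 1 => fun x y => ∑' z, kernelPow K n x z * K z y

open Classical in
/-- A (standard, honest) continuous-time transition function: each `P t` is a stochastic matrix,
`P 0` is the identity, the Chapman-Kolmogorov equations hold, and `P t x x → 1` as `t ↓ 0`. -/
structure IsTransitionFunction (P : ℝ≥0 → S → S → ℝ) : Prop where
  stochastic : ∀ t, IsStochastic (P t)
  zero : ∀ x y, P 0 x y = if x = y then 1 else 0
  chapman_kolmogorov : ∀ s t x y, HasSum (fun z => P s x z * P t z y) (P (s + t) x y)
  standard : ∀ x, Tendsto (fun t => P t x x) (𝓝[>] 0) (𝓝 1)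

/-- `X` is, under `μ`, a time-homogeneous Markov chain (with an arbitrary initial law) with values
in the countable set `S`, with time set `T` (`ℕ` or `ℝ≥0`), and with transition probabilities
`P t x y` from `x` to `y` in time `t`: for all times `t₀ < ⋯ < tₘ` and states `s₀, …, sₘ`,
`μ(X_{t₀} = s₀, …, X_{tₘ} = sₘ) = μ(X_{t₀} = s₀) ∏ᵢ P_{tᵢ₊₁ - tᵢ}(sᵢ, sᵢ₊₁)`. -/
structure IsMarkovChain [LinearOrder T] [Sub T] {Ω : Type*} [MeasurableSpace Ω] (μ : Measure Ω)
    (P : T → S → S → ℝ) (X : T → Ω → S) : Prop where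
  measurableSet_eq : ∀ t s, MeasurableSet {ω | X t ω = s}
  joint_law : ∀ (m : ℕ) (t : Fin (m + 1) → T) (s : Fin (m + 1) → S), StrictMono t →
    μ.real {ω | ∀ i, X (t i) ω = s i} =
      μ.real {ω | X (t 0) ω = s 0} *
        ∏ i : Fin m, P (t i.succ - t i.castSucc) (s i.castSucc) (s i.succ)

/-- A path in a discrete space which is right-continuous and has left limits. -/
def IsCadlagPath (x : ℝ≥0 → S) : Prop :=
  (∀ t, ∀ᶠ s in 𝓝[>] t, x s = x t) ∧ ∀ t, 0 < t → ∃ a, ∀ᶠ s in 𝓝[<] t, x s = a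

/-- Under the map `π`, the matrix `K` projects onto the matrix `K'`: from any `x`, the total
`K`-probability of the fibre of `π` over `y` is `K' (π x) y`. -/
def ProjectsTo (π : S → S') (K : S → S → ℝ) (K' : S' → S' → ℝ) : Prop :=
  ∀ x y, HasSum (fun z : {z : S // π z = y} => K x z) (K' (π x) y)

end Markov

/-! ### The one-level dynamics and the links -/

/-- The Vandermonde product `Δ_n(x) = ∏_{i < j} (x_j - x_i)`. -/
def vandermonde {n : ℕ} (x : Fin n → ℤ) : ℝ :=
  ∏ i, ∏ j ∈ Finset.Ioi i, ((x j : ℝ) - (x i : ℝ))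

/-- The one-particle step: jump one site to the right with probability `p`, else stay put. -/
def oneStep (p : ℝ) (x y : ℤ) : ℝ :=
  if y = x + 1 then p else if y = x then 1 - p else 0

/-- The one-step transition probability of the discrete-time Charlier process on
`W_n = {x ∈ ℤⁿ | x_1 < ⋯ < x_n}`: the `h`-transform `Δ_n(y)/Δ_n(x) · det(P(x_i, y_j))`. -/
def levelStep (p : ℝ) {n : ℕ} (x y : Fin n → ℤ) : ℝ :=
  vandermonde y / vandermonde x * (Matrix.of fun i j => oneStep p (x i) (y j)).det

/-- `y ≺ x`, i.e. `x_1 < y_1 ≤ x_2 < y_2 ≤ ⋯ < y_n ≤ x_{n+1}`. -/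
def Interlaces {n : ℕ} (y : Fin n → ℤ) (x : Fin (n + 1) → ℤ) : Prop :=
  ∀ i : Fin n, x i.castSucc < y i ∧ y i ≤ x i.succ

open Classical in
/-- The Markov link from level `n + 1` to level `n`: `n! · Δ_n(y)/Δ_{n+1}(x) · 1[y ≺ x]`. -/
def link {n : ℕ} (x : Fin (n + 1) → ℤ) (y : Fin n → ℤ) : ℝ :=
  if Interlaces y x then (n.factorial : ℝ) * (vandermonde y / vandermonde x) else 0

/-- The product of the level dynamics with the link: the sum over `z ∈ W_{n+1}` of the
probability of going from `x` to `z` on level `n + 1` and then from `z` to `y` by the link. -/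
def stepLink (p : ℝ) {n : ℕ} (x : Fin (n + 1) → ℤ) (y : Fin n → ℤ) : ℝ :=
  ∑' z : {z : Fin (n + 1) → ℤ // StrictMono z}, levelStep p x z * link z.1 y

/-! ### The chain on Gelfand-Tsetlin patterns -/

/-- Gelfand-Tsetlin patterns with `N` levels. The index `n : Fin N` stands for level `n + 1`, which
has the `n + 1` particles `X n 0 < ⋯ < X n n`. -/
def GT (N : ℕ) : Type :=
  {X : (n : Fin N) → Fin (n.1 + 1) → ℤ //
    ∀ (n : ℕ) (h : n + 1 < N), Interlaces (X ⟨n, Nat.lt_of_succ_lt h⟩) (X ⟨n + 1, h⟩)}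

/-- The normalizing constant on a level: `1` on the first level, and on each other one the
`stepLink` from the old state of the level to the new state of the level below. -/
def gtNorm {N : ℕ} (p : ℝ) (X Y : GT N) : Fin N → ℝ
  | ⟨0, _⟩ => 1
  | ⟨n + 1, h⟩ => stepLink p (X.1 ⟨n + 1, h⟩) (Y.1 ⟨n, Nat.lt_of_succ_lt h⟩)

/-- The conditional probability of the new state of a level, given its old state and
the new state of the level below. -/
def gtFactor {N : ℕ} (p : ℝ) (X Y : GT N) : Fin N → ℝ
  | ⟨0, h⟩ => levelStep p (X.1 ⟨0, h⟩) (Y.1 ⟨0, h⟩)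
  | ⟨n + 1, h⟩ =>
      levelStep p (X.1 ⟨n + 1, h⟩) (Y.1 ⟨n + 1, h⟩) *
        link (Y.1 ⟨n + 1, h⟩) (Y.1 ⟨n, Nat.lt_of_succ_lt h⟩) /
          stepLink p (X.1 ⟨n + 1, h⟩) (Y.1 ⟨n, Nat.lt_of_succ_lt h⟩)

open Classical in
/-- One step of the discrete-time intertwined chain on Gelfand-Tsetlin patterns. -/
def gtStep (N : ℕ) (p : ℝ) (X Y : GT N) : ℝ :=
  if 0 < ∏ n, gtNorm p X Y n then ∏ n, gtFactor p X Y n else 0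

/-- The transition probabilities of the continuous-time intertwined chain: the limit `p ↓ 0` of the
discrete-time chain after `⌊t/p⌋` steps. -/
def gtTransition (N : ℕ) (t : ℝ≥0) (X Y : GT N) : ℝ :=
  limUnder (𝓝[>] (0 : ℝ)) fun p => kernelPow (gtStep N p) ⌊(t : ℝ) / p⌋₊ X Y

/-! ### TASEP with `N` particles -/

/-- Configurations of `N` exclusion particles on `ℤ`, labelled from right to left. -/
def TasepState (N : ℕ) : Type := {x : Fin N → ℤ // StrictAnti x}

/-- The site to the right of particle `n` is empty. -/
def CanJump {N : ℕ} (x : TasepState N) (n : Fin N) : Prop := ∀ m, x.1 m ≠ x.1 n + 1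

/-- Particle `n` jumps one site to the right. -/
def jump {N : ℕ} (x : TasepState N) (n : Fin N) (h : CanJump x n) : TasepState N :=
  ⟨Function.update x.1 n (x.1 n + 1), by
    intro a b hab
    have hx := x.2 hab
    have ha := h a
    by_cases h1 : a = n
    · subst h1
      have h2 : b ≠ a := hab.ne'
      simp only [Function.update_self, Function.update_of_ne h2]
      omega
    · by_cases h2 : b = n
      · subst h2
        simp only [Function.update_self, Function.update_of_ne h1]
        omega
      · simpa only [Function.update_of_ne h1, Function.update_of_ne h2] using hx⟩

open Classical in
/-- The generator of TASEP: each particle jumps to the right at rate `1` if the target site is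
empty. -/
def tasepGenerator (N : ℕ) (f : TasepState N → ℝ) (x : TasepState N) : ℝ :=
  ∑ n, if h : CanJump x n then f (jump x n h) - f x else 0

open Classical in
/-- The transition probabilities `(exp(t L) 1_{y})(x)` of continuous-time TASEP, where `L` is the
generator (a bounded operator on bounded functions), by the exponential series. -/
def tasepTransition (N : ℕ) (t : ℝ≥0) (x y : TasepState N) : ℝ :=
  ∑' k : ℕ, (t : ℝ) ^ k / (k.factorial : ℝ) *
    ((tasepGenerator N)^[k] fun z => if z = y then 1 else 0) x

/-- The factor of a particle in a step of discrete-time TASEP with sequential update: the first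
particle is free; any other one stays put if the site to its right is occupied by the already
updated particle ahead of it, and makes a free step otherwise. -/
def seqTasepFactor {N : ℕ} (p : ℝ) (x y : TasepState N) : Fin N → ℝ
  | ⟨0, h⟩ => oneStep p (x.1 ⟨0, h⟩) (y.1 ⟨0, h⟩)
  | ⟨n + 1, h⟩ =>
      if x.1 ⟨n + 1, h⟩ + 1 = y.1 ⟨n, Nat.lt_of_succ_lt h⟩ then
        (if y.1 ⟨n + 1, h⟩ = x.1 ⟨n + 1, h⟩ then 1 else 0)
      else oneStep p (x.1 ⟨n + 1, h⟩) (y.1 ⟨n + 1, h⟩)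

/-- One step of discrete-time TASEP with sequential update and jump probability `p`. -/
def seqTasepStep (N : ℕ) (p : ℝ) (x y : TasepState N) : ℝ :=
  ∏ n, seqTasepFactor p x y n

/-! ### The projection -/

/-- The projection of a pattern onto the leftmost particles of all levels. -/
def leftmost {N : ℕ} (X : GT N) : TasepState N :=
  ⟨fun n => X.1 n 0, by
    cases N with
    | zero => exact fun a => a.elim0
    | succ N =>
      refine Fin.strictAnti_iff_succ_lt.2 fun i => ?_
      exact (X.2 i.1 (Nat.succ_lt_succ i.2) 0).1⟩

end GTTasep

end

/-!
Both chains are driven by independent bits which are `true` with probability `p`. Particles with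
distinct ordered positions which make steps of size at most one cannot exchange their order, so the
determinants reduce to their diagonal terms, and the Vandermonde products cancel against those of
the link. Thus, in the intertwined chain, each particle makes a free step conditioned to fit the new
row below it, that is, it is blocked, or pushed, or moved by its own bit. A leftmost particle can
only be blocked, and by the leftmost particle of the level below: this is the sequential update of
TASEP.

On `ℓ¹` of the state space the one-step operators are contractions for `0 ≤ p ≤ 1`, equal to the
identity at `p = 0`, and differentiable there with derivative the generator `L`, so their powers
`⌊t/p⌋` converge to `exp (t L)`. Stochasticity and the projection pass to the limit.
-/

noncomputable section

namespace GTTasep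

open scoped lp

/-! ### Operators on `ℓ¹(S)` and their matrices -/

section Ell1

variable {S S' : Type*}

open Classical in
/-- The Dirac mass at `x`, an element of the space `ℓ¹(S)` of finite signed measures on `S`. -/
def dirac (x : S) : ℓ¹(S, ℝ) := lp.single 1 x 1

open Classical in
lemma dirac_apply (x y : S) : dirac x y = if x = y then 1 else 0 := by
  rw [dirac, lp.single_apply, Pi.single_apply]
  simp only [eq_comm]

lemma norm_dirac (x : S) : ‖dirac x‖ = 1 := by
  simp [dirac, lp.norm_single]

lemma hasSum_smul_dirac (f : ℓ¹(S, ℝ)) : HasSum (fun x => f x • dirac x) f := by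
  classical
  simpa [dirac, ← lp.single_smul] using lp.hasSum_single ENNReal.one_ne_top f

lemma clm_ext_dirac {E : Type*} [AddCommMonoid E] [Module ℝ E] [TopologicalSpace E] [T2Space E]
    {A B : ℓ¹(S, ℝ) →L[ℝ] E} (h : ∀ x, A (dirac x) = B (dirac x)) : A = B := by
  ext1 f
  have hA := (hasSum_smul_dirac f).mapL A
  have hB := (hasSum_smul_dirac f).mapL B
  simp only [map_smul, h] at hA hB
  exact hA.unique hB

/-- Evaluation of a measure at a point. -/
def evalAt (x : S) : ℓ¹(S, ℝ) →L[ℝ] ℝ := lp.evalCLM ℝ (fun _ : S => ℝ) 1 x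

lemma evalAt_apply (x : S) (f : ℓ¹(S, ℝ)) : evalAt x f = f x := rfl

/-- The total mass of a measure. -/
def totalMass : ℓ¹(S, ℝ) →L[ℝ] ℝ := lp.tsumCLM ℝ S ℝ

lemma totalMass_apply (f : ℓ¹(S, ℝ)) : totalMass f = ∑' x, f x := rfl

lemma totalMass_dirac (x : S) : totalMass (dirac x) = 1 := by
  classical
  simp [totalMass_apply, dirac_apply]

lemma hasSum_totalMass (f : ℓ¹(S, ℝ)) : HasSum f (totalMass f) := by
  simpa [totalMass_dirac] using (hasSum_smul_dirac f).mapL totalMass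

/-- The push-forward of measures along `φ`, i.e. `f ↦ ∑ x, f x • dirac (φ x)`. -/
def push (φ : S → S') : ℓ¹(S, ℝ) →L[ℝ] ℓ¹(S', ℝ) :=
  lp.tsumCLM ℝ S ℓ¹(S', ℝ) ∘L
    lp.mapCLM 1 (fun x => ContinuousLinearMap.toSpanSingleton ℝ (dirac (φ x))) zero_le_one
      fun _ => by rw [ContinuousLinearMap.norm_toSpanSingleton, norm_dirac]

lemma push_dirac (φ : S → S') (x : S) : push φ (dirac x) = dirac (φ x) := by
  classical
  change ∑' y, dirac x y • dirac (φ y) = dirac (φ x)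
  simp [dirac_apply]

lemma norm_push_le (φ : S → S') : ‖push φ‖ ≤ 1 :=
  (ContinuousLinearMap.opNorm_comp_le _ _).trans
    (mul_le_one₀ lp.norm_tsumCLM_le (norm_nonneg _) (lp.norm_mapCLM_le ..))

lemma push_id : push (id : S → S) = 1 := clm_ext_dirac (push_dirac id)

lemma hasSum_push (φ : S → S') (f : ℓ¹(S, ℝ)) (y : S') :
    HasSum (fun x : {x : S // φ x = y} => f x) (push φ f y) := by
  classical
  have h := ((hasSum_smul_dirac f).mapL (push φ)).mapL (evalAt y)
  change HasSum (f ∘ ((↑) : {x : S | φ x = y} → S)) (evalAt y (push φ f))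
  rw [hasSum_subtype_iff_indicator]
  convert h using 2 with x
  simp only [map_smul, push_dirac, evalAt_apply, dirac_apply, Set.indicator_apply,
    Set.mem_ofPred_eq, smul_eq_mul, mul_ite, mul_one, mul_zero]

/-- The matrix of an operator on `ℓ¹(S)`. Measures are row vectors, so that `mat` reverses
products. -/
def mat (A : ℓ¹(S, ℝ) →L[ℝ] ℓ¹(S, ℝ)) (x y : S) : ℝ := A (dirac x) y

lemma continuous_mat (x y : S) : Continuous fun A : ℓ¹(S, ℝ) →L[ℝ] ℓ¹(S, ℝ) => mat A x y :=
  (evalAt y).continuous.comp (ContinuousLinearMap.apply ℝ ℓ¹(S, ℝ) (dirac x)).continuous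

open Classical in
lemma mat_one (x y : S) : mat 1 x y = if x = y then 1 else 0 := dirac_apply x y

lemma hasSum_mat_mul (A B : ℓ¹(S, ℝ) →L[ℝ] ℓ¹(S, ℝ)) (x y : S) :
    HasSum (fun z => mat A x z * mat B z y) (mat (B * A) x y) := by
  simpa [mat, evalAt_apply] using ((hasSum_smul_dirac (A (dirac x))).mapL B).mapL (evalAt y)

lemma kernelPow_mat (A : ℓ¹(S, ℝ) →L[ℝ] ℓ¹(S, ℝ)) (n : ℕ) :
    kernelPow (mat A) n = mat (A ^ n) := by
  funext x y
  induction n generalizing y with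
  | zero => simp only [kernelPow, pow_zero, mat_one]
  | succ n ih => simp only [kernelPow, ih, pow_succ', (hasSum_mat_mul _ _ x y).tsum_eq]

lemma isStochastic_mat_iff {A : ℓ¹(S, ℝ) →L[ℝ] ℓ¹(S, ℝ)} :
    IsStochastic (mat A) ↔ (∀ x y, 0 ≤ mat A x y) ∧ totalMass ∘L A = totalMass := by
  have hmass : (∀ x, HasSum (mat A x) 1) ↔ totalMass ∘L A = totalMass := by
    refine ⟨fun h => clm_ext_dirac fun x => ?_, fun h x => ?_⟩
    · rw [totalMass_dirac]
      exact (hasSum_totalMass _).unique (h x)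
    · rw [← totalMass_dirac x, ← h]
      exact hasSum_totalMass _
  rw [← hmass]
  exact ⟨fun h => ⟨h.nonneg, h.hasSum_one⟩, fun h => ⟨h.1, h.2⟩⟩

lemma isStochastic_mat_one : IsStochastic (mat (1 : ℓ¹(S, ℝ) →L[ℝ] ℓ¹(S, ℝ))) :=
  isStochastic_mat_iff.2 ⟨fun x y => by rw [mat_one]; positivity, rfl⟩

lemma isStochastic_mat_mul {A B : ℓ¹(S, ℝ) →L[ℝ] ℓ¹(S, ℝ)} (hA : IsStochastic (mat A))
    (hB : IsStochastic (mat B)) : IsStochastic (mat (A * B)) := by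
  refine isStochastic_mat_iff.2 ⟨fun x y => (hasSum_mat_mul B A x y).nonneg fun z =>
    mul_nonneg (hB.nonneg x z) (hA.nonneg z y), ?_⟩
  rw [ContinuousLinearMap.mul_def, ← ContinuousLinearMap.comp_assoc,
    (isStochastic_mat_iff.1 hA).2, (isStochastic_mat_iff.1 hB).2]

lemma isStochastic_mat_pow {A : ℓ¹(S, ℝ) →L[ℝ] ℓ¹(S, ℝ)} (hA : IsStochastic (mat A)) (n : ℕ) :
    IsStochastic (mat (A ^ n)) := by
  induction n with
  | zero => exact isStochastic_mat_one
  | succ n ih => exact pow_succ A n ▸ isStochastic_mat_mul ih hA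

lemma isStochastic_mat_of_tendsto {ι : Type*} {l : Filter ι} [l.NeBot]
    {A : ι → ℓ¹(S, ℝ) →L[ℝ] ℓ¹(S, ℝ)} {B : ℓ¹(S, ℝ) →L[ℝ] ℓ¹(S, ℝ)}
    (hA : ∀ᶠ i in l, IsStochastic (mat (A i))) (h : Tendsto A l (𝓝 B)) :
    IsStochastic (mat B) := by
  refine isStochastic_mat_iff.2 ⟨fun x y => ?_, ?_⟩
  · exact ge_of_tendsto (((continuous_mat x y).tendsto B).comp h)
      (hA.mono fun i hi => hi.nonneg x y)
  · exact tendsto_nhds_unique_of_eventuallyEq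
      (((ContinuousLinearMap.postcomp ℓ¹(S, ℝ) totalMass).continuous.tendsto B).comp h)
      tendsto_const_nhds (hA.mono fun i hi => (isStochastic_mat_iff.1 hi).2)

lemma projectsTo_mat {φ : S → S'} {A : ℓ¹(S, ℝ) →L[ℝ] ℓ¹(S, ℝ)}
    {B : ℓ¹(S', ℝ) →L[ℝ] ℓ¹(S', ℝ)} (h : Function.Semiconj (push φ) A B) :
    ProjectsTo φ (mat A) (mat B) := fun x y => by
  simpa only [mat, h.eq, push_dirac] using hasSum_push φ (A (dirac x)) y

end Ell1

/-! ### Intertwining operators -/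

section Intertwining

variable {E F : Type*} [NormedAddCommGroup E] [NormedSpace ℝ E] [NormedAddCommGroup F]
  [NormedSpace ℝ F]

lemma semiconj_clm_pow {φ : E →L[ℝ] F} {A : E →L[ℝ] E} {B : F →L[ℝ] F}
    (h : Function.Semiconj φ A B) (n : ℕ) : Function.Semiconj φ ⇑(A ^ n) ⇑(B ^ n) := by
  simpa only [FunLike.coe_pow_eq_iterate] using h.iterate_right n

lemma semiconj_clm_of_tendsto {ι : Type*} {l : Filter ι} [l.NeBot] {φ : E →L[ℝ] F}
    {A : ι → E →L[ℝ] E} {A' : E →L[ℝ] E} {B : ι → F →L[ℝ] F} {B' : F →L[ℝ] F}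
    (h : ∀ᶠ i in l, Function.Semiconj φ (A i) (B i)) (hA : Tendsto A l (𝓝 A'))
    (hB : Tendsto B l (𝓝 B')) : Function.Semiconj φ A' B' := fun f =>
  tendsto_nhds_unique_of_eventuallyEq
    ((φ.continuous.tendsto _).comp
      (((ContinuousLinearMap.apply ℝ E f).continuous.tendsto A').comp hA))
    (((ContinuousLinearMap.apply ℝ F (φ f)).continuous.tendsto B').comp hB)
    (h.mono fun _ hi => hi f)

end Intertwining

/-! ### Euler's limit in a Banach algebra -/

section Euler

variable {𝔸 : Type*} [NormedRing 𝔸]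

lemma norm_pow_sub_pow_le {a b : 𝔸} {C : ℝ} (ha : ‖a‖ ≤ 1) (n : ℕ)
    (hb : ∀ k ≤ n, ‖b ^ k‖ ≤ C) : ‖a ^ n - b ^ n‖ ≤ n * ‖a - b‖ * C := by
  induction n with
  | zero => simp
  | succ n ih =>
    have telescope : a ^ (n + 1) - b ^ (n + 1) = a * (a ^ n - b ^ n) + (a - b) * b ^ n := by
      rw [pow_succ', pow_succ']; noncomm_ring
    calc ‖a ^ (n + 1) - b ^ (n + 1)‖ ≤ ‖a‖ * ‖a ^ n - b ^ n‖ + ‖a - b‖ * ‖b ^ n‖ := by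
          rw [telescope]
          exact (norm_add_le _ _).trans (add_le_add (norm_mul_le _ _) (norm_mul_le _ _))
      _ ≤ 1 * (n * ‖a - b‖ * C) + ‖a - b‖ * C := by
          gcongr
          · exact ih fun k hk => hb k (by omega)
          · exact hb n (by omega)
      _ = (n + 1 : ℕ) * ‖a - b‖ * C := by push_cast; ring

lemma tendsto_floor_div_mul {t : ℝ} (ht : 0 ≤ t) :
    Tendsto (fun p : ℝ => ⌊t / p⌋₊ * p) (𝓝[>] 0) (𝓝 t) := by
  simpa [Function.comp_def, div_eq_mul_inv] using
    (tendsto_nat_floor_mul_div_atTop ht).comp (tendsto_inv_nhdsGT_zero (𝕜 := ℝ))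

variable [NormedAlgebra ℝ 𝔸] [CompleteSpace 𝔸]

lemma exp_smul_pow (L : 𝔸) (p : ℝ) (n : ℕ) :
    NormedSpace.exp (p • L) ^ n = NormedSpace.exp ((n * p : ℝ) • L) := by
  let : NormedAlgebra ℚ 𝔸 := .restrictScalars ℚ ℝ 𝔸
  rw [← NormedSpace.exp_nsmul, ← Nat.cast_smul_eq_nsmul ℝ, smul_smul]

lemma continuous_exp_smul (L : 𝔸) : Continuous fun t : ℝ => NormedSpace.exp (t • L) :=
  continuous_iff_continuousAt.2 fun t => (hasDerivAt_exp_smul_const L t).continuousAt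

lemma exp_add_smul (L : 𝔸) (s t : ℝ) :
    NormedSpace.exp ((s + t) • L) = NormedSpace.exp (s • L) * NormedSpace.exp (t • L) := by
  let : NormedAlgebra ℚ 𝔸 := .restrictScalars ℚ ℝ 𝔸
  rw [add_smul, NormedSpace.exp_add_of_commute]
  exact ((Commute.refl L).smul_left s).smul_right t

/-- Telescoping bounds the distance between the powers of `K p` and of `exp (p • L)` by the number
`t / p` of factors times the distance of the factors, which is `o(p)`. -/
theorem tendsto_pow_floor_div {K : ℝ → 𝔸} {L : 𝔸} (hK : ∀ᶠ p in 𝓝[>] (0 : ℝ), ‖K p‖ ≤ 1)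
    (hK0 : K 0 = 1) (hKL : HasDerivAt K L 0) {t : ℝ} (ht : 0 ≤ t) :
    Tendsto (fun p => K p ^ ⌊t / p⌋₊) (𝓝[>] 0) (𝓝 (NormedSpace.exp (t • L))) := by
  obtain ⟨C, hC⟩ := (isCompact_Icc (a := 0) (b := t)).exists_bound_of_continuousOn
    (continuous_exp_smul L).continuousOn
  have hexp : HasDerivAt (fun p : ℝ => NormedSpace.exp (p • L)) L 0 := by
    simpa using hasDerivAt_exp_smul_const L (0 : ℝ)
  have hslope : Tendsto (fun p : ℝ => p⁻¹ • (K p - NormedSpace.exp (p • L))) (𝓝[>] 0) (𝓝 0) := by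
    simpa [hK0] using (hKL.sub hexp).tendsto_slope_zero_right
  have hbound : ∀ᶠ p in 𝓝[>] (0 : ℝ),
      ‖K p ^ ⌊t / p⌋₊ - NormedSpace.exp (p • L) ^ ⌊t / p⌋₊‖ ≤
        ⌊t / p⌋₊ * p * ‖p⁻¹ • (K p - NormedSpace.exp (p • L))‖ * C := by
    filter_upwards [hK, self_mem_nhdsWithin] with p hp (hp0 : 0 < p)
    refine (norm_pow_sub_pow_le (C := C) hp _ fun k hk => ?_).trans (le_of_eq ?_)
    · rw [exp_smul_pow]
      refine hC _ ⟨by positivity, ?_⟩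
      rw [← le_div_iff₀ hp0]
      exact (Nat.cast_le.2 hk).trans (Nat.floor_le (by positivity))
    · rw [norm_smul, Real.norm_eq_abs, abs_of_pos (inv_pos.2 hp0)]
      field_simp
  have hdiff : Tendsto (fun p => K p ^ ⌊t / p⌋₊ - NormedSpace.exp (p • L) ^ ⌊t / p⌋₊)
      (𝓝[>] 0) (𝓝 0) := by
    refine squeeze_zero_norm' hbound ?_
    simpa using ((tendsto_floor_div_mul ht).mul hslope.norm).mul_const C
  have hpow := ((continuous_exp_smul L).tendsto t).comp (tendsto_floor_div_mul ht)
  simpa [exp_smul_pow, Function.comp_def] using hdiff.add hpow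

end Euler

/-! ### Independent bits -/

section Bits

variable {B B' : Type*} [Fintype B] [Fintype B'] {p : ℝ}

/-- The law of a random bit: `true` with probability `p`. -/
def bitWeight (p : ℝ) (c : Bool) : ℝ := if c then p else 1 - p

open Classical in
/-- The probability that a random bit has the property `C`. -/
def bitProb (p : ℝ) (C : Bool → Prop) : ℝ := ∑ c, if C c then bitWeight p c else 0

/-- The law of a finite family of independent random bits. -/
def bitsWeight (p : ℝ) (e : B → Bool) : ℝ := ∏ b, bitWeight p (e b)

lemma bitWeight_nonneg (h0 : 0 ≤ p) (h1 : p ≤ 1) (c : Bool) : 0 ≤ bitWeight p c := by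
  unfold bitWeight; split_ifs <;> linarith

lemma bitWeight_zero (c : Bool) : bitWeight 0 c = if c = false then 1 else 0 := by
  cases c <;> simp [bitWeight]

lemma bitProb_true : bitProb p (fun _ => True) = 1 := by
  simp [bitProb, bitWeight]

lemma bitProb_eq (c : Bool) : bitProb p (fun c' => c' = c) = bitWeight p c := by
  cases c <;> simp [bitProb]

lemma bitProb_pos (h0 : 0 ≤ p) (h1 : p ≤ 1) {C : Bool → Prop} {c : Bool} (hC : C c)
    (hc : bitWeight p c ≠ 0) : 0 < bitProb p C := by
  refine Finset.sum_pos' (fun d _ => ?_) ⟨c, Finset.mem_univ c, ?_⟩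
  · split_ifs
    exacts [bitWeight_nonneg h0 h1 d, le_rfl]
  · rw [if_pos hC]
    exact (bitWeight_nonneg h0 h1 c).lt_of_ne' hc

lemma exists_of_bitProb_ne_zero {C : Bool → Prop} (h : bitProb p C ≠ 0) :
    ∃ c, C c ∧ bitWeight p c ≠ 0 := by
  classical
  obtain ⟨c, -, hc⟩ := Finset.exists_ne_zero_of_sum_ne_zero h
  exact ⟨c, ite_ne_right_iff.1 hc⟩

lemma bitsWeight_nonneg (h0 : 0 ≤ p) (h1 : p ≤ 1) (e : B → Bool) : 0 ≤ bitsWeight p e :=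
  Finset.prod_nonneg fun _ _ => bitWeight_nonneg h0 h1 _

variable [DecidableEq B]

lemma sum_bitsWeight_forall (p : ℝ) (C : B → Bool → Prop)
    [∀ e : B → Bool, Decidable (∀ b, C b (e b))] :
    (∑ e : B → Bool, if ∀ b, C b (e b) then bitsWeight p e else 0) = ∏ b, bitProb p (C b) := by
  classical
  simp only [bitProb, Finset.prod_univ_sum, Fintype.piFinset_univ, Fintype.prod_ite_zero,
    bitsWeight]
  congr!

open Classical in
lemma sum_bitsWeight_comp_eq {ι : B' → B} (hι : ι.Injective) (e' : B' → Bool) :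
    (∑ e : B → Bool, if e ∘ ι = e' then bitsWeight p e else 0) = bitsWeight p e' := by
  have hcond (e : B → Bool) : e ∘ ι = e' ↔ ∀ b, ∀ b', ι b' = b → e b = e' b' := by
    rw [funext_iff]
    exact ⟨fun h b b' hb => hb ▸ h b', fun h b' => h _ b' rfl⟩
  simp only [hcond]
  rw [sum_bitsWeight_forall p fun b c => ∀ b', ι b' = b → c = e' b']
  refine (Fintype.prod_of_injective ι hι _ _ (fun b hb => ?_) fun b' => ?_).symm
  · have hfree (c : Bool) : (∀ b', ι b' = b → c = e' b') ↔ True :=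
      iff_true_intro fun b' h => (hb ⟨b', h⟩).elim
    simp only [hfree, bitProb_true]
  · simp only [hι.eq_iff, forall_eq, bitProb_eq]

variable {V : Type*} [AddCommGroup V] [Module ℝ V]

/-- The expectation of a function of a finite family of independent random bits. -/
def bitsMean (p : ℝ) (F : (B → Bool) → V) : V := ∑ e, bitsWeight p e • F e

lemma bitsMean_const (p : ℝ) (v : V) : bitsMean p (fun _ : B → Bool => v) = v := by
  have hsum : ∑ e : B → Bool, bitsWeight p e = 1 := by
    simpa [bitProb_true] using sum_bitsWeight_forall (B := B) p fun _ _ => True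
  rw [bitsMean, ← Finset.sum_smul, hsum, one_smul]

lemma bitsMean_comp [DecidableEq B'] {ι : B' → B} (hι : ι.Injective) (p : ℝ)
    (F : (B' → Bool) → V) : bitsMean p (fun e : B → Bool => F (e ∘ ι)) = bitsMean p F := by
  classical
  simp only [bitsMean]
  rw [← Finset.sum_fiberwise Finset.univ fun e : B → Bool => e ∘ ι]
  refine Finset.sum_congr rfl fun e' _ => ?_
  rw [← sum_bitsWeight_comp_eq hι e', ← Finset.sum_filter, Finset.sum_smul]
  exact Finset.sum_congr rfl fun e he => by rw [(Finset.mem_filter.1 he).2]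

lemma bitsMean_zero (F : (B → Bool) → V) : bitsMean 0 F = F ⊥ := by
  have hw (e : B → Bool) : bitsWeight 0 e = if e = ⊥ then 1 else 0 := by
    simp only [bitsWeight, bitWeight_zero, Fintype.prod_boole, funext_iff, Pi.bot_apply,
      bot_eq_false]
  simp only [bitsMean, hw, ite_smul, one_smul, zero_smul, Finset.sum_ite_eq', Finset.mem_univ,
    if_true]

variable {E : Type*} [NormedAddCommGroup E] [NormedSpace ℝ E]

lemma norm_bitsMean_le (h0 : 0 ≤ p) (h1 : p ≤ 1) {F : (B → Bool) → E} {C : ℝ}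
    (hF : ∀ e, ‖F e‖ ≤ C) : ‖bitsMean p F‖ ≤ C := by
  rw [← bitsMean_const (B := B) p C]
  refine norm_sum_le_of_le _ fun e _ => ?_
  rw [norm_smul, Real.norm_of_nonneg (bitsWeight_nonneg h0 h1 e), smul_eq_mul]
  exact mul_le_mul_of_nonneg_left (hF e) (bitsWeight_nonneg h0 h1 e)

lemma hasDerivAt_bitWeight (c : Bool) (q : ℝ) :
    HasDerivAt (fun p => bitWeight p c) (if c then 1 else -1) q := by
  cases c with
  | true => simpa [bitWeight] using hasDerivAt_id' q
  | false => simpa [bitWeight] using (hasDerivAt_id q).const_sub 1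

/-- Russo's formula at `p = 0`: only configurations with at most one bit equal to `true` have
probability of order at most one in `p`. -/
lemma hasDerivAt_bitsMean_zero (F : (B → Bool) → E) :
    HasDerivAt (fun p => bitsMean p F) (∑ b, (F (Function.update ⊥ b true) - F ⊥)) 0 := by
  have hproduct := HasDerivAt.fun_sum (u := Finset.univ) fun e : B → Bool => fun _ =>
    (HasDerivAt.fun_finsetProd (u := Finset.univ) fun b _ =>
      hasDerivAt_bitWeight (e b) 0).smul_const (F e)
  refine hproduct.congr_deriv ?_
  simp only [Finset.sum_smul]
  rw [Finset.sum_comm]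
  refine Finset.sum_congr rfl fun b _ => ?_
  have hothers (e : B → Bool) : ∏ j ∈ Finset.univ.erase b, bitWeight 0 (e j) =
      if ∀ j ≠ b, e j = false then 1 else 0 := by
    simp only [bitWeight_zero, Finset.prod_boole, Finset.mem_erase, Finset.mem_univ, and_true]
  simp only [hothers]
  rw [← Fintype.sum_of_injective (Function.update (⊥ : B → Bool) b) (Function.update_injective _ b)
    (fun c => (if c then (1 : ℝ) else -1) • F (Function.update ⊥ b c))]
  · have hoff : Function.update (⊥ : B → Bool) b false = ⊥ := Function.update_eq_self b ⊥
    simp [hoff, sub_eq_add_neg]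
  · intro e he
    rw [if_neg, zero_smul, zero_smul]
    exact fun hj => he ⟨e b, funext fun j => by by_cases h : j = b <;> simp_all⟩
  · simp +contextual [Function.update_of_ne]

end Bits

/-! ### Random mappings driven by independent bits -/

section RandomMap

variable {B B' S S' : Type*} [Fintype B] [DecidableEq B] [Fintype B'] [DecidableEq B']
  {U : (B → Bool) → S → S} {p : ℝ}

/-- The operator on `ℓ¹(S)` of the random mapping `x ↦ U e x`, where the bits `e` are
independent. -/
def randomMapOp (U : (B → Bool) → S → S) (p : ℝ) : ℓ¹(S, ℝ) →L[ℝ] ℓ¹(S, ℝ) :=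
  bitsMean p fun e => push (U e)

/-- The generator of the jump process which applies `U e` at rate one for each family `e` with a
single bit equal to `true`. -/
def randomMapGen (U : (B → Bool) → S → S) : ℓ¹(S, ℝ) →L[ℝ] ℓ¹(S, ℝ) :=
  ∑ b, (push (U (Function.update ⊥ b true)) - push (U ⊥))

/-- The semigroup generated by `randomMapGen U`. -/
def randomMapSemigroup (U : (B → Bool) → S → S) (t : ℝ≥0) : ℓ¹(S, ℝ) →L[ℝ] ℓ¹(S, ℝ) :=
  NormedSpace.exp ((t : ℝ) • randomMapGen U)

lemma randomMapOp_dirac (U : (B → Bool) → S → S) (p : ℝ) (x : S) :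
    randomMapOp U p (dirac x) = bitsMean p fun e => dirac (U e x) := by
  simp only [randomMapOp, bitsMean, sum_apply, smul_apply, push_dirac]

open Classical in
lemma mat_randomMapOp (U : (B → Bool) → S → S) (p : ℝ) (x y : S) :
    mat (randomMapOp U p) x y = ∑ e, if U e x = y then bitsWeight p e else 0 := by
  rw [mat, ← evalAt_apply, randomMapOp_dirac, bitsMean, map_sum]
  simp only [map_smul, evalAt_apply, dirac_apply, smul_eq_mul, mul_ite, mul_one, mul_zero]

lemma isStochastic_randomMapOp (U : (B → Bool) → S → S) (h0 : 0 ≤ p) (h1 : p ≤ 1) :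
    IsStochastic (mat (randomMapOp U p)) := by
  classical
  refine isStochastic_mat_iff.2 ⟨fun x y => ?_, clm_ext_dirac fun x => ?_⟩
  · rw [mat_randomMapOp]
    exact Finset.sum_nonneg fun e _ => ite_nonneg (bitsWeight_nonneg h0 h1 e) le_rfl
  · rw [ContinuousLinearMap.comp_apply, randomMapOp_dirac, bitsMean, map_sum, totalMass_dirac]
    simpa only [bitsMean, map_smul, totalMass_dirac] using bitsMean_const (B := B) p (1 : ℝ)

lemma semiconj_randomMapOp {φ : S → S'} {V : (B' → Bool) → S' → S'} {ι : B' → B}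
    (hι : ι.Injective) (h : ∀ e x, φ (U e x) = V (e ∘ ι) (φ x)) (p : ℝ) :
    Function.Semiconj (push φ) (randomMapOp U p) (randomMapOp V p) := by
  suffices push φ ∘L randomMapOp U p = randomMapOp V p ∘L push φ from DFunLike.congr_fun this
  refine clm_ext_dirac fun x => ?_
  rw [ContinuousLinearMap.comp_apply, ContinuousLinearMap.comp_apply, push_dirac,
    randomMapOp_dirac, randomMapOp_dirac, ← bitsMean_comp hι]
  simp only [bitsMean, map_sum, map_smul, push_dirac, h]

lemma eventually_mem_Icc_zero_one : ∀ᶠ p in 𝓝[>] (0 : ℝ), p ∈ Set.Icc 0 1 := by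
  filter_upwards [Ioc_mem_nhdsGT (zero_lt_one (α := ℝ))] with p hp using Set.Ioc_subset_Icc_self hp

lemma tendsto_randomMapOp_pow (hU : U ⊥ = id) (t : ℝ≥0) :
    Tendsto (fun p => randomMapOp U p ^ ⌊(t : ℝ) / p⌋₊) (𝓝[>] 0) (𝓝 (randomMapSemigroup U t)) := by
  refine tendsto_pow_floor_div ?_ ?_ (hasDerivAt_bitsMean_zero fun e => push (U e)) t.2
  · exact eventually_mem_Icc_zero_one.mono fun p hp =>
      norm_bitsMean_le hp.1 hp.2 fun e => norm_push_le (U e)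
  · rw [bitsMean_zero, hU, push_id]

lemma tendsto_kernelPow_randomMapOp {K : ℝ → S → S → ℝ}
    (hK : ∀ p ∈ Set.Icc (0 : ℝ) 1, K p = mat (randomMapOp U p)) (hU : U ⊥ = id) (t : ℝ≥0)
    (x y : S) :
    Tendsto (fun p => kernelPow (K p) ⌊(t : ℝ) / p⌋₊ x y) (𝓝[>] 0)
      (𝓝 (mat (randomMapSemigroup U t) x y)) := by
  refine (((continuous_mat x y).tendsto _).comp (tendsto_randomMapOp_pow hU t)).congr' ?_
  filter_upwards [eventually_mem_Icc_zero_one] with p hp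
  rw [hK p hp, kernelPow_mat, Function.comp_apply]

lemma isStochastic_randomMapSemigroup (hU : U ⊥ = id) (t : ℝ≥0) :
    IsStochastic (mat (randomMapSemigroup U t)) :=
  isStochastic_mat_of_tendsto (eventually_mem_Icc_zero_one.mono fun _ hp =>
    isStochastic_mat_pow (isStochastic_randomMapOp U hp.1 hp.2) _) (tendsto_randomMapOp_pow hU t)

lemma randomMapSemigroup_zero : randomMapSemigroup U 0 = 1 := by
  rw [randomMapSemigroup, NNReal.coe_zero, zero_smul, NormedSpace.exp_zero]

lemma randomMapSemigroup_add (s t : ℝ≥0) :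
    randomMapSemigroup U (s + t) = randomMapSemigroup U t * randomMapSemigroup U s := by
  rw [add_comm]
  exact exp_add_smul (randomMapGen U) t s

lemma continuous_randomMapSemigroup : Continuous (randomMapSemigroup U) :=
  (continuous_exp_smul (randomMapGen U)).comp NNReal.continuous_coe

lemma isTransitionFunction_randomMapSemigroup (hU : U ⊥ = id) :
    IsTransitionFunction fun t => mat (randomMapSemigroup U t) where
  stochastic := isStochastic_randomMapSemigroup hU
  zero x y := by rw [randomMapSemigroup_zero, mat_one]
  chapman_kolmogorov s t x y := by
    rw [randomMapSemigroup_add]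
    exact hasSum_mat_mul _ _ x y
  standard x := by
    have hcont := ((continuous_mat x x).comp (continuous_randomMapSemigroup (U := U))).tendsto 0
    rw [Function.comp_apply, randomMapSemigroup_zero, mat_one, if_pos rfl] at hcont
    exact hcont.mono_left nhdsWithin_le_nhds

lemma semiconj_randomMapSemigroup {φ : S → S'} {V : (B' → Bool) → S' → S'} {ι : B' → B}
    (hι : ι.Injective) (h : ∀ e x, φ (U e x) = V (e ∘ ι) (φ x)) (hU : U ⊥ = id) (hV : V ⊥ = id)
    (t : ℝ≥0) : Function.Semiconj (push φ) (randomMapSemigroup U t) (randomMapSemigroup V t) :=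
  semiconj_clm_of_tendsto (.of_forall fun p => semiconj_clm_pow (semiconj_randomMapOp hι h p) _)
    (tendsto_randomMapOp_pow hU t) (tendsto_randomMapOp_pow hV t)

lemma mat_randomMapSemigroup (t : ℝ≥0) (x y : S) :
    mat (randomMapSemigroup U t) x y =
      ∑' k : ℕ, (t : ℝ) ^ k / (k.factorial : ℝ) * mat (randomMapGen U ^ k) x y := by
  have hexp := ((NormedSpace.exp_series_hasSum_exp' (𝕂 := ℝ) ((t : ℝ) • randomMapGen U)).mapL
    (ContinuousLinearMap.apply ℝ ℓ¹(S, ℝ) (dirac x))).mapL (evalAt y)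
  refine hexp.tsum_eq.symm.trans (tsum_congr fun k => ?_)
  simp [smul_pow, mat, evalAt_apply, div_eq_inv_mul, mul_assoc]

end RandomMap

/-! ### Functions of Markov chains -/

section Projection

lemma hasSum_measureReal_fiber {Ω C D : Type*} [MeasurableSpace Ω] (μ : Measure Ω)
    [IsFiniteMeasure μ] [Countable C] {Z : Ω → C} (hZ : ∀ c, MeasurableSet {ω | Z ω = c})
    (ψ : C → D) (d : D) (A : Set Ω) :
    HasSum (fun c : {c // ψ c = d} => μ.real (A ∩ {ω | Z ω = c}))
      (μ.real (A ∩ {ω | ψ (Z ω) = d})) := by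
  have hunion : {ω | ψ (Z ω) = d} = ⋃ c : {c // ψ c = d}, {ω | Z ω = c} := by ext; simp
  have hdisj : Pairwise (Function.onFun Disjoint fun c : {c // ψ c = d} => {ω | Z ω = c}) :=
    fun c c' hc => Set.disjoint_left.2 fun ω (h : Z ω = c) h' => hc (Subtype.ext (h.symm.trans h'))
  have hmeas : MeasurableSet {ω | ψ (Z ω) = d} := hunion ▸ .iUnion fun c => hZ c
  have hsum := measure_iUnion (μ := μ.restrict A) hdisj fun c => hZ c
  rw [← hunion] at hsum
  have hreal := ENNReal.hasSum_toReal (hsum ▸ measure_ne_top (μ.restrict A) _)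
  rw [← ENNReal.tsum_toReal_eq fun c => measure_ne_top _ _, ← hsum] at hreal
  simpa only [Measure.real, Measure.restrict_apply (hZ _), Measure.restrict_apply hmeas,
    Set.inter_comm] using hreal

variable {S S' T Ω : Type*} [LinearOrder T] [Sub T] [MeasurableSpace Ω] {μ : Measure Ω}
  {P : T → S → S → ℝ} {X : T → Ω → S}

lemma isMarkovChain_iff_last_step : IsMarkovChain μ P X ↔ (∀ t s, MeasurableSet {ω | X t ω = s}) ∧
    ∀ (m : ℕ) (t : Fin (m + 2) → T) (z : Fin (m + 1) → S) (b : S), StrictMono t →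
      μ.real ({ω | (fun i => X (Fin.init t i) ω) = z} ∩ {ω | X (t (Fin.last _)) ω = b}) =
        μ.real {ω | (fun i => X (Fin.init t i) ω) = z} *
          P (t (Fin.last _) - Fin.init t (Fin.last m)) (z (Fin.last m)) b := by
  have hinit {m : ℕ} {t : Fin (m + 2) → T} (ht : StrictMono t) : StrictMono (Fin.init t) :=
    ht.comp Fin.strictMono_castSucc
  have hevent {m : ℕ} (t : Fin (m + 2) → T) (s : Fin (m + 2) → S) :
      {ω | ∀ i, X (t i) ω = s i} = {ω | (fun i => X (Fin.init t i) ω) = Fin.init s} ∩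
        {ω | X (t (Fin.last _)) ω = s (Fin.last _)} := by
    ext ω
    simp only [Set.mem_ofPred_eq, Set.mem_inter_iff, Fin.forall_fin_succ' (n := m + 1), funext_iff,
      Fin.init]
  refine ⟨fun h => ⟨h.measurableSet_eq, fun m t z b ht => ?_⟩, fun h => ⟨h.1, fun m => ?_⟩⟩
  · obtain ⟨s, rfl, rfl⟩ : ∃ s : Fin (m + 2) → S, Fin.init s = z ∧ s (Fin.last _) = b :=
      ⟨Fin.snoc (α := fun _ => S) z b, Fin.init_snoc (α := fun _ => S) .., Fin.snoc_last ..⟩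
    have hpast := h.joint_law m (Fin.init t) (Fin.init s) (hinit ht)
    simp only [← funext_iff] at hpast
    rw [← hevent, h.joint_law (m + 1) t s ht, hpast, Fin.prod_univ_castSucc, ← mul_assoc]
    rfl
  · induction m with
    | zero => simp
    | succ m ih =>
      intro t s ht
      have hpast := ih (Fin.init t) (Fin.init s) (hinit ht)
      simp only [← funext_iff] at hpast
      rw [hevent, h.2 m t _ _ ht, hpast, Fin.prod_univ_castSucc, ← mul_assoc]
      rfl

/-- The fibre over the last state is summed first, then the fibre over the past. -/
theorem IsMarkovChain.project [Countable S] [IsFiniteMeasure μ] {P' : T → S' → S' → ℝ}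
    {φ : S → S'} (hP : ∀ t, ProjectsTo φ (P t) (P' t)) (hX : IsMarkovChain μ P X) :
    IsMarkovChain μ P' fun t ω => φ (X t ω) := by
  obtain ⟨hmeas, hstep⟩ := isMarkovChain_iff_last_step.1 hX
  refine isMarkovChain_iff_last_step.2 ⟨fun t s => ?_, fun m t s d ht => ?_⟩
  · have hunion : {ω | φ (X t ω) = s} = ⋃ z : {z // φ z = s}, {ω | X t ω = z} := by ext; simp
    exact hunion ▸ .iUnion fun z => hmeas t z
  set past : Ω → Fin (m + 1) → S := fun ω i => X (Fin.init t i) ω with hpast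
  set r := t (Fin.last _) - Fin.init t (Fin.last m)
  have hmeasPast (z) : MeasurableSet {ω | past ω = z} := by
    simp only [hpast, funext_iff, Set.ofPred_forall]
    exact .iInter fun i => hmeas _ _
  have hstep' (z : {z : Fin (m + 1) → S // φ ∘ z = s}) :
      μ.real ({ω | φ (X (t (Fin.last _)) ω) = d} ∩ {ω | past ω = z}) =
        μ.real (Set.univ ∩ {ω | past ω = z}) * P' r (s (Fin.last m)) d := by
    have hfiber := hasSum_measureReal_fiber μ (hmeas (t (Fin.last _))) φ d {ω | past ω = z}
    simp only [hpast, hstep m t z _ ht] at hfiber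
    have hlast : φ (z.1 (Fin.last m)) = s (Fin.last m) := congrFun z.2 _
    rw [Set.inter_comm, Set.univ_inter, ← hlast]
    exact hfiber.unique ((hP r (z.1 (Fin.last m)) d).mul_left _)
  have hfiber (A : Set Ω) := hasSum_measureReal_fiber μ hmeasPast (φ ∘ ·) s A
  have hjoint := hfiber {ω | φ (X (t (Fin.last _)) ω) = d}
  simp only [hstep'] at hjoint
  have := hjoint.unique ((hfiber Set.univ).mul_right _)
  rwa [Set.univ_inter, Set.inter_comm] at this

lemma IsCadlagPath.comp {x : ℝ≥0 → S} (h : IsCadlagPath x) (φ : S → S') :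
    IsCadlagPath fun t => φ (x t) :=
  ⟨fun t => (h.1 t).mono fun _ hs => congrArg φ hs, fun t ht =>
    let ⟨a, ha⟩ := h.2 t ht
    ⟨φ a, ha.mono fun _ hs => congrArg φ hs⟩⟩

end Projection

/-! ### One level of the intertwined dynamics -/

section Level

lemma vandermonde_pos {n : ℕ} {x : Fin n → ℤ} (hx : StrictMono x) : 0 < vandermonde x :=
  Finset.prod_pos fun _ _ => Finset.prod_pos fun _ hj =>
    sub_pos.2 (Int.cast_lt.2 (hx (Finset.mem_Ioi.1 hj)))

/-- The displacement coded by a bit. -/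
def bitStep (c : Bool) : ℤ := if c then 1 else 0

lemma oneStep_eq_bitProb (p : ℝ) (a z : ℤ) :
    oneStep p a z = bitProb p fun c => a + bitStep c = z := by
  rw [bitProb, Fintype.sum_bool]
  simp only [oneStep, bitStep, bitWeight, if_true, add_zero, Bool.false_eq_true, if_false]
  split_ifs <;> first | omega | simp

lemma oneStep_ne_zero_iff {p : ℝ} {a z : ℤ} :
    oneStep p a z ≠ 0 ↔ ∃ c, a + bitStep c = z ∧ bitWeight p c ≠ 0 := by
  rw [Bool.exists_bool]
  simp only [oneStep, bitStep, bitWeight, if_true, add_zero, Bool.false_eq_true, if_false]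
  grind

lemma eq_add_one_or_eq_of_oneStep_ne_zero {p : ℝ} {a z : ℤ} (h : oneStep p a z ≠ 0) :
    z = a + 1 ∨ z = a := by
  obtain ⟨_ | _, rfl, -⟩ := oneStep_ne_zero_iff.1 h
  exacts [.inr (add_zero a), .inl rfl]

/-- No two particles of a strictly ordered configuration can exchange their positions by jumps of
size at most one, so that only the identity contributes to the determinant. -/
lemma levelStep_eq (p : ℝ) {n : ℕ} {x y : Fin n → ℤ} (hx : StrictMono x) (hy : StrictMono y) :
    levelStep p x y = vandermonde y / vandermonde x * ∏ i, oneStep p (x i) (y i) := by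
  rw [levelStep, Matrix.det_apply, Finset.sum_eq_single 1 _ (by simp)]
  · simp
  · intro σ _ hσ
    suffices ∏ i, oneStep p (x (σ i)) (y i) = 0 by simp [this]
    by_contra hprod
    have hstep i := eq_add_one_or_eq_of_oneStep_ne_zero (Finset.prod_ne_zero_iff.1 hprod i
      (Finset.mem_univ i))
    have hmono : StrictMono σ := fun i j hij => by
      by_contra! hji
      have := hx (hji.lt_of_ne fun h => hij.ne' (σ.injective h))
      have := hy hij
      grind
    exact hσ (Equiv.ext fun i => congrFun hmono.eq_id i)

/-- The position `a` of particle `i` is compatible with the row `y` below: `y_{i-1} ≤ a < y_i`. -/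
def Fits {n : ℕ} (y : Fin n → ℤ) (i : Fin (n + 1)) (a : ℤ) : Prop :=
  (∀ j : Fin n, j.castSucc = i → a < y j) ∧ ∀ j : Fin n, j.succ = i → y j ≤ a

lemma interlaces_iff_fits {n : ℕ} {y : Fin n → ℤ} {x : Fin (n + 1) → ℤ} :
    Interlaces y x ↔ ∀ i, Fits y i (x i) :=
  ⟨fun h _ => ⟨fun j hj => hj ▸ (h j).1, fun j hj => hj ▸ (h j).2⟩,
    fun h j => ⟨(h _).1 j rfl, (h _).2 j rfl⟩⟩

lemma Interlaces.strictMono {n : ℕ} {y : Fin n → ℤ} {x : Fin (n + 1) → ℤ} (h : Interlaces y x) :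
    StrictMono x :=
  Fin.strictMono_iff_lt_succ.2 fun i => (h i).1.trans_le (h i).2

/-- The probability that a free step from `a` is compatible with the row `y` below. -/
def fitProb (p : ℝ) {n : ℕ} (y : Fin n → ℤ) (i : Fin (n + 1)) (a : ℤ) : ℝ :=
  bitProb p fun c => Fits y i (a + bitStep c)

lemma fitProb_pos {p : ℝ} (h0 : 0 ≤ p) (h1 : p ≤ 1) {n : ℕ} {y : Fin n → ℤ} {i : Fin (n + 1)}
    {a z : ℤ} (hz : Fits y i z) (hstep : oneStep p a z ≠ 0) : 0 < fitProb p y i a := by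
  obtain ⟨c, rfl, hc⟩ := oneStep_ne_zero_iff.1 hstep
  exact bitProb_pos h0 h1 hz hc

open Classical in
/-- The Vandermonde determinant of the intermediate configuration cancels. -/
lemma levelStep_mul_link (p : ℝ) {n : ℕ} {x z : Fin (n + 1) → ℤ} (y : Fin n → ℤ)
    (hx : StrictMono x) (hz : StrictMono z) :
    levelStep p x z * link z y = n.factorial * (vandermonde y / vandermonde x) *
      if Interlaces y z then ∏ i, oneStep p (x i) (z i) else 0 := by
  have hzpos := (vandermonde_pos hz).ne'
  rw [levelStep_eq p hx hz, link]
  split_ifs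
  · field_simp
  · simp

open Classical in
lemma prod_oneStep_eq (p : ℝ) {n : ℕ} (x z : Fin n → ℤ) :
    ∏ i, oneStep p (x i) (z i) =
      ∑ e : Fin n → Bool, if (fun i => x i + bitStep (e i)) = z then bitsWeight p e else 0 := by
  simp only [oneStep_eq_bitProb, ← sum_bitsWeight_forall, funext_iff]

open Classical in
lemma hasSum_prod_oneStep (p : ℝ) {n : ℕ} (x : Fin (n + 1) → ℤ) (y : Fin n → ℤ) :
    HasSum (fun z : {z : Fin (n + 1) → ℤ // StrictMono z} =>
      if Interlaces y z.1 then ∏ i, oneStep p (x i) (z.1 i) else 0)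
      (∏ i, fitProb p y i (x i)) := by
  have hterm (z : Fin (n + 1) → ℤ) :
      (if Interlaces y z then ∏ i, oneStep p (x i) (z i) else 0) =
        ∑ e : Fin (n + 1) → Bool, if Interlaces y z then
          if (fun i => x i + bitStep (e i)) = z then bitsWeight p e else 0 else 0 := by
    rw [prod_oneStep_eq, Finset.sum_ite_irrel, Finset.sum_const_zero]
  simp only [hterm, fitProb, ← sum_bitsWeight_forall]
  refine hasSum_sum fun e _ => ?_
  by_cases he : ∀ i, Fits y i (x i + bitStep (e i))
  · have hinterlaces : Interlaces y fun i => x i + bitStep (e i) := interlaces_iff_fits.2 he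
    rw [if_pos he]
    convert hasSum_ite_eq (⟨_, hinterlaces.strictMono⟩ : {z : Fin (n + 1) → ℤ // StrictMono z})
      (bitsWeight p e) using 2 with z
    rw [← ite_and]
    refine if_congr ⟨fun h => Subtype.ext h.2.symm, ?_⟩ rfl rfl
    rintro rfl
    exact ⟨hinterlaces, rfl⟩
  · rw [if_neg he]
    convert hasSum_zero with z
    refine ite_eq_right_iff.2 fun hz => if_neg fun h => he ?_
    exact interlaces_iff_fits.1 (h ▸ hz)

lemma stepLink_eq (p : ℝ) {n : ℕ} {x : Fin (n + 1) → ℤ} (y : Fin n → ℤ) (hx : StrictMono x) :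
    stepLink p x y =
      n.factorial * (vandermonde y / vandermonde x) * ∏ i, fitProb p y i (x i) := by
  rw [stepLink, tsum_congr fun z => levelStep_mul_link p y hx z.2]
  exact ((hasSum_prod_oneStep p x y).mul_left _).tsum_eq

open Classical in
/-- The new position of particle `i` at `a`, given the new row `y` below and a bit: the particle
is blocked or pushed by the row below if need be, and makes a free step otherwise. -/
def nextPos {n : ℕ} (y : Fin n → ℤ) (i : Fin (n + 1)) (a : ℤ) (c : Bool) : ℤ :=
  if Fits y i (a + 1) then if Fits y i a then a + bitStep c else a + 1 else a

lemma nextPos_eq_or {n : ℕ} (y : Fin n → ℤ) (i : Fin (n + 1)) (a : ℤ) (c : Bool) :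
    nextPos y i a c = a + 1 ∨ nextPos y i a c = a := by
  cases c <;> simp only [nextPos, bitStep] <;> split_ifs <;> simp

lemma oneStep_div_fitProb (p : ℝ) {n : ℕ} {y : Fin n → ℤ} {i : Fin (n + 1)} {a z : ℤ}
    (hz : Fits y i z) (hstep : oneStep p a z ≠ 0) :
    oneStep p a z / fitProb p y i a = bitProb p fun c => nextPos y i a c = z := by
  obtain ⟨_ | _, rfl, hc⟩ := oneStep_ne_zero_iff.1 hstep
  · simp only [bitStep, bitWeight, if_false, add_zero, Bool.false_eq_true] at hz hc
    by_cases h : Fits y i (a + 1) <;>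
      simp [oneStep, fitProb, bitProb, nextPos, bitStep, bitWeight, hz, h, hc]
  · simp only [bitStep, bitWeight, if_true] at hz hc
    by_cases h : Fits y i a <;>
      simp [oneStep, fitProb, bitProb, nextPos, bitStep, bitWeight, hz, h, hc]

variable {n : ℕ} {x y : Fin n → ℤ} {i : Fin (n + 1)} {a : ℤ}

lemma exists_pusher_of_not_fits (ha : Fits x i a) (hxy : ∀ j, y j = x j + 1 ∨ y j = x j)
    (h : ¬ Fits y i a) : ∃ j : Fin n, j.succ = i ∧ y j = a + 1 ∧ y j = x j + 1 := by
  by_contra! hnone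
  refine h ⟨fun j hj => ?_, fun j hj => ?_⟩
  · have := ha.1 j hj
    have := hxy j
    omega
  · have := ha.2 j hj
    have := hxy j
    have := hnone j hj
    omega

lemma exists_blocker_of_not_fits_succ (ha : Fits x i a) (hxy : ∀ j, y j = x j + 1 ∨ y j = x j)
    (h : ¬ Fits y i (a + 1)) : ∃ j : Fin n, j.castSucc = i ∧ y j = a + 1 ∧ y j = x j := by
  by_contra! hnone
  refine h ⟨fun j hj => ?_, fun j hj => ?_⟩
  · have := ha.1 j hj
    have := hxy j
    have := hnone j hj
    omega
  · have := ha.2 j hj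
    have := hxy j
    omega

lemma fits_nextPos (ha : Fits x i a) (hxy : ∀ j, y j = x j + 1 ∨ y j = x j)
    (hy : StrictMono y) (c : Bool) : Fits y i (nextPos y i a c) := by
  unfold nextPos
  split_ifs with hright hleft
  · cases c <;> simpa [bitStep]
  · exact hright
  · by_contra hleft
    obtain ⟨j, hj, hja, -⟩ := exists_pusher_of_not_fits ha hxy hleft
    obtain ⟨k, hk, hka, -⟩ := exists_blocker_of_not_fits_succ ha hxy hright
    have hjk : j < k := by
      rw [← Fin.castSucc_lt_castSucc_iff, hk, ← hj]
      exact Fin.castSucc_lt_succ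
    exact (hy hjk).ne (hja.trans hka.symm)

/-- A pushed particle follows a particle below which has made a step to the right, and a blocked
one a particle below which has stayed: at `p = 0` and `p = 1` too, the forced step is possible. -/
lemma oneStep_nextPos_ne_zero {p : ℝ} {c : Bool} (ha : Fits x i a)
    (hxy : ∀ j, oneStep p (x j) (y j) ≠ 0) (hc : bitWeight p c ≠ 0) :
    oneStep p a (nextPos y i a c) ≠ 0 := by
  have hxy' j := eq_add_one_or_eq_of_oneStep_ne_zero (hxy j)
  have hsame {j : Fin n} {z : ℤ} (h : z - a = y j - x j) : oneStep p a z ≠ 0 := by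
    obtain ⟨d, hd, hd'⟩ := oneStep_ne_zero_iff.1 (hxy j)
    exact oneStep_ne_zero_iff.2 ⟨d, by omega, hd'⟩
  unfold nextPos
  split_ifs with hright hleft
  · exact oneStep_ne_zero_iff.2 ⟨c, rfl, hc⟩
  · obtain ⟨j, -, -, hj⟩ := exists_pusher_of_not_fits ha hxy' hleft
    exact hsame (j := j) (by omega)
  · obtain ⟨j, -, -, hj⟩ := exists_blocker_of_not_fits_succ ha hxy' hright
    exact hsame (j := j) (by omega)

end Level

/-! ### The intertwined chain as a random mapping -/

section Pattern

variable {N : ℕ}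

instance : Countable (GT N) := Subtype.countable

/-- The index set of the particles of a pattern with `N` levels. -/
abbrev GTIndex (N : ℕ) : Type := Σ n : Fin N, Fin (n.1 + 1)

/-- The row below a given one. The row below the first one is empty, which makes the first level
a special case of the others. -/
def rowBelow (Y : GT N) : (n : Fin N) → Fin n.1 → ℤ
  | ⟨0, _⟩ => Fin.elim0
  | ⟨n + 1, h⟩ => Y.1 ⟨n, Nat.lt_of_succ_lt h⟩

lemma interlaces_rowBelow (Y : GT N) : ∀ n : Fin N, Interlaces (rowBelow Y n) (Y.1 n)
  | ⟨0, _⟩ => fun i => i.elim0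
  | ⟨n + 1, h⟩ => Y.2 n h

lemma GT.strictMono (Y : GT N) (n : Fin N) : StrictMono (Y.1 n) :=
  (interlaces_rowBelow Y n).strictMono

lemma fits_rowBelow (Y : GT N) (n : Fin N) (i : Fin (n.1 + 1)) : Fits (rowBelow Y n) i (Y.1 n i) :=
  interlaces_iff_fits.1 (interlaces_rowBelow Y n) i

lemma fits_of_isEmpty (y : Fin 0 → ℤ) (i : Fin 1) (a : ℤ) : Fits y i a :=
  ⟨fun j => j.elim0, fun j => j.elim0⟩

lemma gtNorm_pos {p : ℝ} (h0 : 0 ≤ p) (h1 : p ≤ 1) {X Y : GT N}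
    (hstep : ∀ n i, oneStep p (X.1 n i) (Y.1 n i) ≠ 0) : ∀ n, 0 < gtNorm p X Y n
  | ⟨0, _⟩ => zero_lt_one
  | ⟨n + 1, h⟩ => by
    rw [gtNorm, stepLink_eq p _ (X.strictMono _)]
    have hX := vandermonde_pos (X.strictMono ⟨n + 1, h⟩)
    have hY := vandermonde_pos (Y.strictMono ⟨n, Nat.lt_of_succ_lt h⟩)
    have hfit : 0 < ∏ i, fitProb p (Y.1 ⟨n, Nat.lt_of_succ_lt h⟩) i (X.1 ⟨n + 1, h⟩ i) :=
      Finset.prod_pos fun i _ =>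
        fitProb_pos h0 h1 (fits_rowBelow Y ⟨n + 1, h⟩ i) (hstep ⟨n + 1, h⟩ i)
    positivity

lemma gtFactor_eq (p : ℝ) (X Y : GT N) : ∀ n, gtFactor p X Y n =
    ∏ i, oneStep p (X.1 n i) (Y.1 n i) / fitProb p (rowBelow Y n) i (X.1 n i)
  | ⟨0, h⟩ => by
    have hvandermonde (x : Fin 1 → ℤ) : vandermonde x = 1 := by simp [vandermonde]
    have hfit (i : Fin 1) (a : ℤ) : fitProb p (rowBelow Y ⟨0, h⟩) i a = 1 := by
      simp only [fitProb, fits_of_isEmpty, bitProb_true]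
    rw [gtFactor, levelStep_eq p (X.strictMono _) (Y.strictMono _), hvandermonde, hvandermonde,
      div_one, one_mul]
    exact Finset.prod_congr rfl fun i _ => by rw [hfit, div_one]
  | ⟨n + 1, h⟩ => by
    have hX := vandermonde_pos (X.strictMono ⟨n + 1, h⟩)
    have hY := vandermonde_pos (Y.strictMono ⟨n, Nat.lt_of_succ_lt h⟩)
    rw [gtFactor, stepLink_eq p _ (X.strictMono _),
      levelStep_mul_link p _ (X.strictMono _) (Y.strictMono _), if_pos (Y.2 n h),
      mul_div_mul_left _ _ (by positivity), Finset.prod_div_distrib]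
    rfl

lemma gtStep_eq_zero {p : ℝ} {X Y : GT N} {n : Fin N} {i : Fin (n.1 + 1)}
    (h : oneStep p (X.1 n i) (Y.1 n i) = 0) : gtStep N p X Y = 0 := by
  refine ite_eq_right_iff.2 fun _ => Finset.prod_eq_zero (Finset.mem_univ n) ?_
  rw [gtFactor_eq]
  exact Finset.prod_eq_zero (Finset.mem_univ i) (by rw [h, zero_div])

lemma oneStep_ne_zero_of_nextPos {p : ℝ} {X Y : GT N}
    (h : ∀ n i, bitProb p (fun c => nextPos (rowBelow Y n) i (X.1 n i) c = Y.1 n i) ≠ 0)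
    (n : Fin N) (i : Fin (n.1 + 1)) : oneStep p (X.1 n i) (Y.1 n i) ≠ 0 := by
  have hlevel (n : Fin N) (x : Fin n.1 → ℤ) (hx : ∀ i, Fits x i (X.1 n i))
      (hbelow : ∀ j, oneStep p (x j) (rowBelow Y n j) ≠ 0) (i : Fin (n.1 + 1)) :
      oneStep p (X.1 n i) (Y.1 n i) ≠ 0 := by
    obtain ⟨c, hcY, hc⟩ := exists_of_bitProb_ne_zero (h n i)
    exact hcY ▸ oneStep_nextPos_ne_zero (hx i) hbelow hc
  obtain ⟨n, hn⟩ := n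
  induction n with
  | zero => exact hlevel _ _ (fits_rowBelow X ⟨0, hn⟩) (fun j => j.elim0) i
  | succ n ih => exact hlevel _ _ (fits_rowBelow X ⟨n + 1, hn⟩) (ih _) i

lemma gtStep_eq_prod {p : ℝ} (h0 : 0 ≤ p) (h1 : p ≤ 1) (X Y : GT N) : gtStep N p X Y =
    ∏ n, ∏ i, bitProb p fun c => nextPos (rowBelow Y n) i (X.1 n i) c = Y.1 n i := by
  by_cases hstep : ∀ n i, oneStep p (X.1 n i) (Y.1 n i) ≠ 0
  · rw [gtStep, if_pos (Finset.prod_pos fun n _ => gtNorm_pos h0 h1 hstep n)]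
    simp only [gtFactor_eq, oneStep_div_fitProb p (fits_rowBelow Y _ _) (hstep _ _)]
  · have hprod := mt oneStep_ne_zero_of_nextPos hstep
    push Not at hstep hprod
    obtain ⟨n, i, hni⟩ := hstep
    obtain ⟨m, j, hmj⟩ := hprod
    rw [gtStep_eq_zero hni, Finset.prod_eq_zero (Finset.mem_univ m)
      (Finset.prod_eq_zero (Finset.mem_univ j) hmj)]

/-- The rows of the pattern after one step of the intertwined dynamics driven by given bits, from
the first level up. -/
def rowUpdate (e : GTIndex N → Bool) (X : GT N) : (n : ℕ) → (h : n < N) → Fin (n + 1) → ℤ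
  | 0, h => fun i => nextPos (n := 0) Fin.elim0 i (X.1 ⟨0, h⟩ i) (e ⟨⟨0, h⟩, i⟩)
  | n + 1, h => fun i =>
      nextPos (rowUpdate e X n (Nat.lt_of_succ_lt h)) i (X.1 ⟨n + 1, h⟩ i) (e ⟨⟨n + 1, h⟩, i⟩)

lemma rowUpdate_eq_or (e : GTIndex N → Bool) (X : GT N) (n : ℕ) (h : n < N) (i : Fin (n + 1)) :
    rowUpdate e X n h i = X.1 ⟨n, h⟩ i + 1 ∨ rowUpdate e X n h i = X.1 ⟨n, h⟩ i := by
  cases n <;> exact nextPos_eq_or _ _ _ _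

lemma interlaces_rowUpdate (e : GTIndex N → Bool) (X : GT N) (n : ℕ) (h : n + 1 < N) :
    Interlaces (rowUpdate e X n (Nat.lt_of_succ_lt h)) (rowUpdate e X (n + 1) h) := by
  have hnext (hmono : StrictMono (rowUpdate e X n (Nat.lt_of_succ_lt h))) :
      Interlaces (rowUpdate e X n (Nat.lt_of_succ_lt h)) (rowUpdate e X (n + 1) h) :=
    interlaces_iff_fits.2 fun i =>
      fits_nextPos (fits_rowBelow X ⟨n + 1, h⟩ i) (rowUpdate_eq_or e X n _) hmono _
  refine hnext ?_
  cases n with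
  | zero => exact Subsingleton.strictMono (α := Fin 1) _
  | succ n => exact (interlaces_rowUpdate e X n _).strictMono

/-- The pattern after one step of the intertwined dynamics driven by given bits. -/
def gtUpdate (e : GTIndex N → Bool) (X : GT N) : GT N :=
  ⟨fun n => rowUpdate e X n.1 n.2, interlaces_rowUpdate e X⟩

lemma gtUpdate_apply (e : GTIndex N → Bool) (X : GT N) (n : Fin N) (i : Fin (n.1 + 1)) :
    (gtUpdate e X).1 n i = nextPos (rowBelow (gtUpdate e X) n) i (X.1 n i) (e ⟨n, i⟩) := by
  obtain ⟨_ | n, h⟩ := n <;> rfl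

lemma gtUpdate_eq_iff {e : GTIndex N → Bool} {X Y : GT N} :
    gtUpdate e X = Y ↔
      ∀ b : GTIndex N, nextPos (rowBelow Y b.1) b.2 (X.1 b.1 b.2) (e b) = Y.1 b.1 b.2 := by
  refine ⟨?_, fun h => Subtype.ext (funext fun ⟨n, hn⟩ => ?_)⟩
  · rintro rfl b
    exact (gtUpdate_apply e X b.1 b.2).symm
  · induction n with
    | zero => exact funext fun i => h ⟨⟨0, hn⟩, i⟩
    | succ n ih =>
      funext i
      rw [gtUpdate_apply, ← h ⟨⟨n + 1, hn⟩, i⟩]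
      simp only [rowBelow, ih]

lemma gtStep_eq_mat {p : ℝ} (hp : p ∈ Set.Icc (0 : ℝ) 1) :
    gtStep N p = mat (randomMapOp gtUpdate p) := by
  classical
  funext X Y
  simp only [gtStep_eq_prod hp.1 hp.2, mat_randomMapOp, gtUpdate_eq_iff]
  rw [sum_bitsWeight_forall p fun (b : GTIndex N) c =>
    nextPos (rowBelow Y b.1) b.2 (X.1 b.1 b.2) c = Y.1 b.1 b.2, Fintype.prod_sigma]

lemma gtUpdate_bot : gtUpdate (⊥ : GTIndex N → Bool) = id := by
  funext X
  refine gtUpdate_eq_iff.2 fun b => ?_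
  simp [nextPos, fits_rowBelow, bitStep]

end Pattern

/-! ### Sequential TASEP as a random mapping -/

section Tasep

variable {N : ℕ}

/-- The new position of particle `n` of sequential TASEP at `a`, given the new configuration `y`
of the particles ahead of it and a bit. -/
def tasepNext (y : Fin N → ℤ) : Fin N → ℤ → Bool → ℤ
  | ⟨0, _⟩, a, c => a + bitStep c
  | ⟨n + 1, h⟩, a, c => if a + 1 = y ⟨n, Nat.lt_of_succ_lt h⟩ then a else a + bitStep c

lemma le_tasepNext (y : Fin N → ℤ) (n : Fin N) (a : ℤ) (c : Bool) : a ≤ tasepNext y n a c := by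
  obtain ⟨_ | n, h⟩ := n <;> cases c <;> simp only [tasepNext, bitStep] <;> split_ifs <;> omega

lemma tasepNext_false (y : Fin N → ℤ) (n : Fin N) (a : ℤ) : tasepNext y n a false = a := by
  obtain ⟨_ | n, h⟩ := n <;> simp [tasepNext, bitStep]

/-- The positions of the particles after a step of sequential TASEP driven by given bits. -/
def tasepUpdatePos (e : Fin N → Bool) (x : Fin N → ℤ) : (n : ℕ) → n < N → ℤ
  | 0, h => x ⟨0, h⟩ + bitStep (e ⟨0, h⟩)
  | n + 1, h => if x ⟨n + 1, h⟩ + 1 = tasepUpdatePos e x n (Nat.lt_of_succ_lt h) then x ⟨n + 1, h⟩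
      else x ⟨n + 1, h⟩ + bitStep (e ⟨n + 1, h⟩)

lemma tasepUpdatePos_eq (e : Fin N → Bool) (x : Fin N → ℤ) (n : ℕ) (h : n < N) :
    tasepUpdatePos e x n h =
      tasepNext (fun m => tasepUpdatePos e x m.1 m.2) ⟨n, h⟩ (x ⟨n, h⟩) (e ⟨n, h⟩) := by
  cases n <;> rfl

lemma TasepState.succ_lt (x : TasepState N) (n : ℕ) (h : n + 1 < N) :
    x.1 ⟨n + 1, h⟩ < x.1 ⟨n, Nat.lt_of_succ_lt h⟩ :=
  x.2 (Fin.mk_lt_mk.2 n.lt_succ_self)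

lemma tasepUpdatePos_succ_lt (e : Fin N → Bool) (x : TasepState N) (n : ℕ) (h : n + 1 < N) :
    tasepUpdatePos e x.1 (n + 1) h < tasepUpdatePos e x.1 n (Nat.lt_of_succ_lt h) := by
  have hgap := x.succ_lt n h
  have hahead : x.1 ⟨n, Nat.lt_of_succ_lt h⟩ ≤ tasepUpdatePos e x.1 n (Nat.lt_of_succ_lt h) :=
    (le_tasepNext ..).trans_eq (tasepUpdatePos_eq ..).symm
  simp only [tasepUpdatePos, bitStep]
  split_ifs <;> omega

/-- The configuration after a step of sequential TASEP driven by given bits. -/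
def tasepUpdate (e : Fin N → Bool) (x : TasepState N) : TasepState N :=
  ⟨fun n => tasepUpdatePos e x.1 n.1 n.2, by
    cases N with
    | zero => exact Subsingleton.strictAnti _
    | succ N => exact Fin.strictAnti_iff_succ_lt.2 fun i =>
        tasepUpdatePos_succ_lt e x i.1 (Nat.succ_lt_succ i.2)⟩

lemma tasepUpdate_apply (e : Fin N → Bool) (x : TasepState N) (n : Fin N) :
    (tasepUpdate e x).1 n = tasepNext (tasepUpdate e x).1 n (x.1 n) (e n) :=
  tasepUpdatePos_eq e x.1 n.1 n.2

lemma tasepUpdate_eq_iff {e : Fin N → Bool} {x y : TasepState N} :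
    tasepUpdate e x = y ↔ ∀ n, tasepNext y.1 n (x.1 n) (e n) = y.1 n := by
  refine ⟨?_, fun h => Subtype.ext (funext fun ⟨n, hn⟩ => ?_)⟩
  · rintro rfl n
    exact (tasepUpdate_apply e x n).symm
  · induction n with
    | zero => exact h ⟨0, hn⟩
    | succ n ih =>
      rw [tasepUpdate_apply, ← h ⟨n + 1, hn⟩]
      simp only [tasepNext, ih]

lemma seqTasepFactor_eq (p : ℝ) (x y : TasepState N) (n : Fin N) :
    seqTasepFactor p x y n = bitProb p fun c => tasepNext y.1 n (x.1 n) c = y.1 n := by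
  obtain ⟨_ | n, h⟩ := n
  · exact oneStep_eq_bitProb ..
  · simp only [seqTasepFactor, tasepNext]
    split_ifs with hblocked hstay
    · simp only [hstay, bitProb_true]
    · simp [bitProb, Ne.symm hstay]
    · exact oneStep_eq_bitProb ..

lemma seqTasepStep_eq_mat (p : ℝ) : seqTasepStep N p = mat (randomMapOp tasepUpdate p) := by
  classical
  funext x y
  simp only [seqTasepStep, seqTasepFactor_eq, mat_randomMapOp, tasepUpdate_eq_iff]
  exact (sum_bitsWeight_forall p fun n c => tasepNext y.1 n (x.1 n) c = y.1 n).symm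

lemma tasepUpdate_bot : tasepUpdate (⊥ : Fin N → Bool) = id :=
  funext fun _ => tasepUpdate_eq_iff.2 fun _ => tasepNext_false ..

/-- The index of the leftmost particle of a level. -/
def leftmostIndex (n : Fin N) : GTIndex N := ⟨n, 0⟩

lemma leftmostIndex_injective : Function.Injective (leftmostIndex (N := N)) :=
  fun _ _ h => congrArg Sigma.fst h

lemma fits_zero_iff {n : ℕ} {y : Fin (n + 1) → ℤ} {a : ℤ} : Fits y 0 a ↔ a < y 0 :=
  ⟨fun h => h.1 0 rfl, fun h => ⟨fun _ hj => Fin.castSucc_eq_zero_iff.1 hj ▸ h,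
    fun j hj => absurd hj j.succ_ne_zero⟩⟩

/-- A leftmost particle is never pushed, since no particle of the row below is to its left, and it
is blocked exactly by the leftmost particle of the level below. -/
lemma leftmost_gtUpdate (e : GTIndex N → Bool) (X : GT N) :
    leftmost (gtUpdate e X) = tasepUpdate (e ∘ leftmostIndex) (leftmost X) := by
  refine (tasepUpdate_eq_iff.2 fun ⟨n, h⟩ => ?_).symm
  change _ = (gtUpdate e X).1 ⟨n, h⟩ 0
  rw [gtUpdate_apply]
  cases n with
  | zero =>
    simp only [tasepNext, nextPos, fits_of_isEmpty, if_true]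
    rfl
  | succ n =>
    have hgap : X.1 ⟨n + 1, h⟩ 0 < X.1 ⟨n, Nat.lt_of_succ_lt h⟩ 0 := (X.2 n h 0).1
    have hbelow := rowUpdate_eq_or e X n (Nat.lt_of_succ_lt h) 0
    have hfits a : Fits (rowBelow (gtUpdate e X) ⟨n + 1, h⟩) 0 a ↔
        a < rowUpdate e X n (Nat.lt_of_succ_lt h) 0 := fits_zero_iff
    simp only [nextPos, hfits]
    change (if X.1 ⟨n + 1, h⟩ 0 + 1 = rowUpdate e X n (Nat.lt_of_succ_lt h) 0 then
      X.1 ⟨n + 1, h⟩ 0 else X.1 ⟨n + 1, h⟩ 0 + bitStep (e ⟨⟨n + 1, h⟩, 0⟩)) = _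
    split_ifs <;> omega

end Tasep

/-! ### The generator of TASEP -/

section Generator

variable {N : ℕ}

lemma canJump_zero (x : TasepState N) (h : 0 < N) : CanJump x ⟨0, h⟩ := fun m hm => by
  have := x.2.antitone (Fin.mk_le_of_le_val m.1.zero_le : ⟨0, h⟩ ≤ m)
  omega

lemma canJump_succ_iff {x : TasepState N} {n : ℕ} {h : n + 1 < N} :
    CanJump x ⟨n + 1, h⟩ ↔ x.1 ⟨n + 1, h⟩ + 1 ≠ x.1 ⟨n, Nat.lt_of_succ_lt h⟩ := by
  refine ⟨fun hjump => (hjump _).symm, fun hne m hm => ?_⟩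
  have hgap := x.succ_lt n h
  rcases lt_or_ge n m.1 with hnm | hmn
  · have := x.2.antitone (show ⟨n + 1, h⟩ ≤ m from hnm)
    omega
  · have := x.2.antitone (show m ≤ ⟨n, Nat.lt_of_succ_lt h⟩ from hmn)
    omega

open Classical in
lemma tasepNext_true (x : TasepState N) (n : Fin N) :
    tasepNext x.1 n (x.1 n) true = if CanJump x n then x.1 n + 1 else x.1 n := by
  obtain ⟨_ | n, h⟩ := n
  · simp [tasepNext, bitStep, canJump_zero]
  · simp [tasepNext, bitStep, canJump_succ_iff]

lemma tasepNext_update (y : Fin N → ℤ) (n : Fin N) (a : ℤ) :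
    tasepNext (Function.update y n a) n = tasepNext y n := by
  obtain ⟨_ | n, h⟩ := n
  · rfl
  · funext b c
    simp [tasepNext]

open Classical in
lemma tasepUpdate_single (x : TasepState N) (n : Fin N) :
    tasepUpdate (Function.update ⊥ n true) x = if h : CanJump x n then jump x n h else x := by
  have hpos : (if h : CanJump x n then jump x n h else x).1 =
      Function.update x.1 n (if CanJump x n then x.1 n + 1 else x.1 n) := by
    split_ifs
    · rfl
    · exact (Function.update_eq_self n x.1).symm
  refine tasepUpdate_eq_iff.2 fun m => ?_
  rw [hpos]
  obtain rfl | hmn := eq_or_ne m n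
  · rw [tasepNext_update, Function.update_self, Function.update_self, tasepNext_true]
  · rw [Function.update_of_ne hmn, Function.update_of_ne hmn, Pi.bot_apply]
    exact tasepNext_false ..

open Classical in
lemma randomMapGen_tasepUpdate_dirac (x : TasepState N) :
    randomMapGen tasepUpdate (dirac x) =
      ∑ n, if h : CanJump x n then dirac (jump x n h) - dirac x else 0 := by
  rw [randomMapGen, sum_apply]
  refine Finset.sum_congr rfl fun n _ => ?_
  rw [sub_apply, push_dirac, push_dirac, tasepUpdate_single, tasepUpdate_bot]
  split_ifs
  · rfl
  · exact sub_self _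

/-- The operator on `ℓ¹` is dual to the generator, which acts on functions. -/
lemma tasepGenerator_dual (f : ℓ¹(TasepState N, ℝ) →L[ℝ] ℝ) (x : TasepState N) :
    tasepGenerator N (fun z => f (dirac z)) x = f (randomMapGen tasepUpdate (dirac x)) := by
  simp only [randomMapGen_tasepUpdate_dirac, map_sum, apply_dite f, map_sub, map_zero,
    tasepGenerator]

open Classical in
lemma mat_randomMapGen_pow (k : ℕ) (x y : TasepState N) :
    mat (randomMapGen tasepUpdate ^ k) x y =
      ((tasepGenerator N)^[k] fun z => if z = y then 1 else 0) x := by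
  induction k generalizing x with
  | zero => rw [pow_zero, mat_one, Function.iterate_zero_apply]
  | succ k ih =>
    rw [Function.iterate_succ_apply', ← funext ih, pow_succ]
    exact (tasepGenerator_dual (evalAt y ∘L randomMapGen tasepUpdate ^ k) x).symm

lemma tasepTransition_eq_mat (t : ℝ≥0) :
    tasepTransition N t = mat (randomMapSemigroup tasepUpdate t) := by
  funext x y
  simp only [mat_randomMapSemigroup, tasepTransition, mat_randomMapGen_pow]

end Generator

/-! ### The projection onto the leftmost particles -/

section Projection

variable {N : ℕ}

lemma gtTransition_eq_mat (t : ℝ≥0) :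
    gtTransition N t = mat (randomMapSemigroup gtUpdate t) :=
  funext₂ fun X Y =>
    (tendsto_kernelPow_randomMapOp (fun _ => gtStep_eq_mat) gtUpdate_bot t X Y).limUnder_eq

lemma projectsTo_gtStep {p : ℝ} (hp : p ∈ Set.Icc (0 : ℝ) 1) :
    ProjectsTo leftmost (gtStep N p) (seqTasepStep N p) := by
  rw [gtStep_eq_mat hp, seqTasepStep_eq_mat]
  exact projectsTo_mat (semiconj_randomMapOp leftmostIndex_injective leftmost_gtUpdate p)

lemma projectsTo_kernelPow_gtStep {p : ℝ} (hp : p ∈ Set.Icc (0 : ℝ) 1) (k : ℕ) :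
    ProjectsTo leftmost (kernelPow (gtStep N p) k) (kernelPow (seqTasepStep N p) k) := by
  rw [gtStep_eq_mat hp, seqTasepStep_eq_mat, kernelPow_mat, kernelPow_mat]
  exact projectsTo_mat (semiconj_clm_pow
    (semiconj_randomMapOp leftmostIndex_injective leftmost_gtUpdate p) k)

lemma projectsTo_gtTransition (t : ℝ≥0) :
    ProjectsTo leftmost (gtTransition N t) (tasepTransition N t) := by
  rw [gtTransition_eq_mat, tasepTransition_eq_mat]
  exact projectsTo_mat (semiconj_randomMapSemigroup leftmostIndex_injective leftmost_gtUpdate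
    gtUpdate_bot tasepUpdate_bot t)

end Projection

end GTTasep

end

theorem mainTheorem1 (N : ℕ) :
    -- discrete time
    (∀ p : ℝ, 0 ≤ p → p ≤ 1 →
      GTTasep.IsStochastic (GTTasep.gtStep N p) ∧
      GTTasep.IsStochastic (GTTasep.seqTasepStep N p) ∧
      GTTasep.ProjectsTo GTTasep.leftmost (GTTasep.gtStep N p) (GTTasep.seqTasepStep N p) ∧
      ∀ (Ω : Type*) [MeasurableSpace Ω] (μ : Measure Ω) [IsProbabilityMeasure μ]
        (X : ℕ → Ω → GTTasep.GT N),
        GTTasep.IsMarkovChain μ (GTTasep.kernelPow (GTTasep.gtStep N p)) X →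
        GTTasep.IsMarkovChain μ (GTTasep.kernelPow (GTTasep.seqTasepStep N p))
          (fun k ω => GTTasep.leftmost (X k ω))) ∧
    -- the limits of small jump probability and large time
    (∀ (t : ℝ≥0) (X Y : GTTasep.GT N),
      Tendsto (fun p : ℝ => GTTasep.kernelPow (GTTasep.gtStep N p) ⌊(t : ℝ) / p⌋₊ X Y)
        (𝓝[>] 0) (𝓝 (GTTasep.gtTransition N t X Y))) ∧
    (∀ (t : ℝ≥0) (x y : GTTasep.TasepState N),
      Tendsto (fun p : ℝ => GTTasep.kernelPow (GTTasep.seqTasepStep N p) ⌊(t : ℝ) / p⌋₊ x y)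
        (𝓝[>] 0) (𝓝 (GTTasep.tasepTransition N t x y))) ∧
    -- continuous time
    GTTasep.IsTransitionFunction (GTTasep.gtTransition N) ∧
    GTTasep.IsTransitionFunction (GTTasep.tasepTransition N) ∧
    (∀ t : ℝ≥0, GTTasep.ProjectsTo GTTasep.leftmost
      (GTTasep.gtTransition N t) (GTTasep.tasepTransition N t)) ∧
    ∀ (Ω : Type*) [MeasurableSpace Ω] (μ : Measure Ω) [IsProbabilityMeasure μ]
      (X : ℝ≥0 → Ω → GTTasep.GT N),
      GTTasep.IsMarkovChain μ (GTTasep.gtTransition N) X →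
      GTTasep.IsMarkovChain μ (GTTasep.tasepTransition N)
        (fun t ω => GTTasep.leftmost (X t ω)) ∧
      ∀ ω, GTTasep.IsCadlagPath (fun t => X t ω) →
        GTTasep.IsCadlagPath (fun t => GTTasep.leftmost (X t ω)) := by
  open GTTasep in
  refine ⟨fun p h0 h1 => ?_, fun t X Y => ?_, fun t x y => ?_,
    funext gtTransition_eq_mat ▸ isTransitionFunction_randomMapSemigroup gtUpdate_bot,
    funext tasepTransition_eq_mat ▸ isTransitionFunction_randomMapSemigroup tasepUpdate_bot,
    projectsTo_gtTransition, fun Ω _ μ _ X hX =>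
      ⟨hX.project projectsTo_gtTransition, fun ω hω => hω.comp leftmost⟩⟩
  · refine ⟨?_, ?_, projectsTo_gtStep ⟨h0, h1⟩, fun Ω _ μ _ X hX =>
      hX.project (projectsTo_kernelPow_gtStep ⟨h0, h1⟩)⟩
    · exact gtStep_eq_mat ⟨h0, h1⟩ ▸ isStochastic_randomMapOp gtUpdate h0 h1
    · exact seqTasepStep_eq_mat p ▸ isStochastic_randomMapOp tasepUpdate h0 h1
  · rw [gtTransition_eq_mat]
    exact tendsto_kernelPow_randomMapOp (fun _ => gtStep_eq_mat) gtUpdate_bot t X Y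
  · rw [tasepTransition_eq_mat]
    exact tendsto_kernelPow_randomMapOp (fun p _ => seqTasepStep_eq_mat p) tasepUpdate_bot t x y
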